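/- Let $F$ be a field with a fixed embedding into $\mathbf{C}$, and let $E\colon y^2=x^3+Ax+B$ with $A,B\in F$ be an elliptic curve over $F$ (for example, $F$ is the Hilbert class field of an imaginary quadratic field $K$ and $E$ has complex multiplication by the ring of integers of $K$). Let $L\subset\mathbf{C}$ be the period lattice of $(E,dx/2y)$, that is, the lattice for which $z\mapsto(\wp(z,L),\wp'(z,L)/2)$ induces a bijection $\mathbf{C}/L\to E(\mathbf{C})$ (under which $dx/2y$ pulls back to $dz$). For $k\ge 1$ put $\mathrm{BH}_k=k!\sum_{0\ne\mu\in L}\mu^{-k}$ if $k\ge 4$ is even, and $\mathrm{BH}_k=0$ otherwise. Let $$\sigma(z,L)=z\prod_{0\ne\mu\in L}(1-z/\mu)e^{z/\mu+(z/\mu)^2/2},\qquad s_2(L)=\lim_{s\to0^+}\sum_{0\ne\mu\in L}\mu^{-2}|\mu|^{-2s},$$ let $\Delta(L)=\Omega^{-12}q\prod_{n\ge1}(1-q^n)^{24}$, where $L=\Omega\,(2\pi i\tau\mathbf{Z}+2\pi i\mathbf{Z})$ with $\Omega\in\mathbf{C}^\times$, $\mathrm{Im}(\tau)>0$ and $q=e^{2\pi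 i\tau}$, and put $\theta(z,L)=\Delta(L)e^{-6s_2(L)z^2}\sigma(z,L)^{12}$. For coprime integers $c,N>1$ define $$\Theta_c(z,L)=\frac{\theta(z,L)^{c^2}}{\theta(cz,L)},\qquad \Lambda_{c,N}(z,L)=\prod_{0\ne\rho\in N^{-1}L/L}\Theta_c(z+\rho,L).$$ Then $\Lambda_{c,N}(z,L)$ is holomorphic and nonzero at $z=0$, and the Taylor expansion $F_{c,N}(z)$ at $z=0$ of $\frac{d}{dz}\log\Lambda_{c,N}(z,L)=\Lambda_{c,N}'(z,L)/\Lambda_{c,N}(z,L)$ has all its coefficients in $F$, that is, $F_{c,N}(z)\in F[[z]]$. Moreover $$F_{c,N}(z)=12\sum_{k\ge0}(c^2-c^{k+1})(1-N^{k+1})\frac{\mathrm{BH}_{k+1}}{(k+1)!}z^k .$$ -/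

import Mathlib

noncomputable section

namespace BernoulliHurwitz

open Filter Topology PeriodPair

/-- `L` is the period lattice of the elliptic curve `E : y² = x³ + Ax + B` (a short Weierstrass
curve over a field `F` embedded in `ℂ`) with respect to the differential `ω = dx / (2y)`: the map
`z ↦ (℘(z, L), ℘'(z, L) / 2)` induces a bijection of `ℂ / L` with the group `E(ℂ)` of complex
points. As `d℘(z) = ℘'(z) dz`, this map pulls `ω` back to `dz`, so that `L` is the group of
the integrals of `ω` along closed paths on `E(ℂ)`. -/
def IsPeriodLattice {F : Type*} [Field F] [Algebra F ℂ] (E : WeierstrassCurve F)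
    (L : PeriodPair) : Prop :=
  ∃ φ : (ℂ ⧸ L.lattice) ≃ (E.baseChange ℂ).toAffine.Point,
    φ 0 = .zero ∧
    ∀ z : ℂ, z ∉ L.lattice →
      ∃ h : (E.baseChange ℂ).toAffine.Nonsingular (L.weierstrassP z) (L.derivWeierstrassP z / 2),
        φ (L.lattice.mkQ z) = .some _ _ h

/-- The Bernoulli–Hurwitz numbers: `BH_k = k! ∑_{0 ≠ μ ∈ L} μ⁻ᵏ` for even `k ≥ 4`, and `0`
for all other `k`. -/
def BH (L : PeriodPair) (k : ℕ) : ℂ :=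
  if 4 ≤ k ∧ Even k then
    (k.factorial : ℂ) * ∑' μ : {μ : L.lattice // μ ≠ 0}, ((μ : ℂ) ^ k)⁻¹
  else 0

/-- `s₂(L) = lim_{s → 0⁺} ∑_{0 ≠ μ ∈ L} μ⁻² |μ|⁻²ˢ`. -/
def s₂ (L : PeriodPair) : ℂ :=
  limUnder (𝓝[>] (0 : ℝ)) fun s : ℝ =>
    ∑' μ : {μ : L.lattice // μ ≠ 0}, ((μ : ℂ) ^ 2)⁻¹ * ((‖(μ : ℂ)‖ ^ (-2 * s) : ℝ) : ℂ)

/-- The discriminant of a lattice: if `L = Ω (2πiτ ℤ + 2πi ℤ)` with `Im τ > 0`, then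
`Δ(L) = Ω⁻¹² q ∏_{n ≥ 1} (1 - qⁿ)²⁴ = Ω⁻¹² η(τ)²⁴`, where `q = exp(2πiτ)` and `η` is the Dedekind
eta function. The two cases are the two possible orientations of the basis. -/
def latticeDelta (L : PeriodPair) : ℂ :=
  if 0 < (L.ω₁ / L.ω₂).im then
    ((L.ω₂ / (2 * Real.pi * Complex.I)) ^ 12)⁻¹ * ModularForm.eta (L.ω₁ / L.ω₂) ^ 24
  else
    ((L.ω₁ / (2 * Real.pi * Complex.I)) ^ 12)⁻¹ * ModularForm.eta (L.ω₂ / L.ω₁) ^ 24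

/-- The Weierstrass sigma function
`σ(z, L) = z ∏_{0 ≠ μ ∈ L} (1 - z/μ) exp(z/μ + (z/μ)²/2)`. -/
def sigma (L : PeriodPair) (z : ℂ) : ℂ :=
  z * ∏' μ : {μ : L.lattice // μ ≠ 0},
    (1 - z / (μ : ℂ)) * Complex.exp (z / (μ : ℂ) + (z / (μ : ℂ)) ^ 2 / 2)

/-- `θ(z, L) = Δ(L) exp(-6 s₂(L) z²) σ(z, L)¹²`. -/
def theta (L : PeriodPair) (z : ℂ) : ℂ :=
  latticeDelta L * Complex.exp (-6 * s₂ L * z ^ 2) * sigma L z ^ 12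

/-- `Θ_c(z, L) = θ(z, L)^(c²) / θ(cz, L)`. -/
def Theta (c : ℕ) (L : PeriodPair) (z : ℂ) : ℂ :=
  theta L z ^ (c ^ 2) / theta L (c * z)

/-- `Λ_{c,N}(z, L) = ∏_{0 ≠ ρ ∈ N⁻¹L/L} Θ_c(z + ρ, L)`, the nonzero classes being represented by
`ρ = (d₁ω₁ + d₂ω₂) / N` with `0 ≤ d₁, d₂ < N` and `(d₁, d₂) ≠ (0, 0)`. -/
def Lam (c N : ℕ) (L : PeriodPair) (z : ℂ) : ℂ :=
  ∏ d ∈ (Finset.range N ×ˢ Finset.range N).erase (0, 0),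
    Theta c L (z + ((d.1 : ℂ) * L.ω₁ + (d.2 : ℂ) * L.ω₂) / N)

/-- `F_{c,N}(z)`: the Taylor series at `0` of `d/dz log Λ_{c,N}(z, L) = Λ'_{c,N} / Λ_{c,N}`. -/
def Fseries (c N : ℕ) (L : PeriodPair) : PowerSeries ℂ :=
  PowerSeries.mk fun k => iteratedDeriv k (logDeriv (Lam c N L)) 0 / (k.factorial : ℂ)

end BernoulliHurwitz

end

noncomputable section

namespace BernoulliHurwitz

open Filter Topology PeriodPair

/-! ### The Weierstrass sigma product -/

section

/-! The logarithmic derivative of `theta` is `12 ζ(z) - 12 s₂ z`. In `Theta` the terms in `s₂`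
cancel, since `c² · z = c · (cz)`, and what remains is `12 D(z)` with `D(z) = c² ζ(z) - c ζ(cz)`.
The quasi-periods cancel in the same way, so `D` is an odd elliptic function with `D'(z) = c² (℘(cz)
- ℘(z))`.

Let `S` be the sum of the translates of `D` by the nonzero `N`-division points. Then `S(0) = 0`
because `D` is odd and `-1` permutes these points (`zetaDiffSum_zero`), and `S'(0) = 0` because `c`
is prime to `N` and permutes them too (`deriv_zetaDiffSum_zero`). For `S''` the distribution
relation `∑ ℘'(z + ρ) = N³ ℘'(Nz)` over all `N`-division classes
(`sum_derivWeierstrassP_add_divisionPoint`) gives a combination of `℘'` at `Ncz`, `cz`, `Nz` and `z`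
whose poles cancel; its Taylor coefficients are multiples of Eisenstein series. Passing to `℘'`
keeps all lattice sums absolutely convergent.

For rationality, comparing the equation of `E` with that of `℘` gives `g₂ = -4A` and `g₃ = -4B`
(`invariants_of_isPeriodLattice`). The differential equation of `℘` then determines its Laurent
coefficients recursively over any field containing `g₂` and `g₃` (`coeff_mem_of_sq_eq`, `G_mem`). -/

/-- The Weierstrass elementary factor `(1 - w) exp(w + w²/2)` of genus two. -/
def elementaryFactor (w : ℂ) : ℂ := (1 - w) * Complex.exp (w + w ^ 2 / 2)

lemma hasDerivAt_elementaryFactor (w : ℂ) :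
    HasDerivAt elementaryFactor (-w ^ 2 * Complex.exp (w + w ^ 2 / 2)) w := by
  have h1 : HasDerivAt (fun w : ℂ => w + w ^ 2 / 2) (1 + w) w := by
    have := (hasDerivAt_id w).add (((hasDerivAt_id w).pow 2).div_const 2)
    convert! this using 1
    simp
  have h2 := ((hasDerivAt_const w (1 : ℂ)).sub (hasDerivAt_id w)).mul h1.cexp
  convert! h2 using 1
  simp
  ring

@[fun_prop]
lemma differentiable_elementaryFactor : Differentiable ℂ elementaryFactor :=
  fun w => (hasDerivAt_elementaryFactor w).differentiableAt

lemma elementaryFactor_ne_zero {w : ℂ} (hw : w ≠ 1) : elementaryFactor w ≠ 0 :=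
  mul_ne_zero (sub_ne_zero.2 hw.symm) (Complex.exp_ne_zero _)

/-- Mean value inequality: the derivative `-w² exp(w + w²/2)` is at most `3‖w‖²` on the disc, as the
exponent has norm at most `1` and `e < 3`. -/
lemma norm_elementaryFactor_sub_one_le {w : ℂ} (hw : ‖w‖ ≤ 1 / 2) :
    ‖elementaryFactor w - 1‖ ≤ 3 * ‖w‖ ^ 3 := by
  have h := (convex_closedBall (0 : ℂ) ‖w‖).norm_image_sub_le_of_norm_hasDerivWithin_le
    (f := elementaryFactor) (C := 3 * ‖w‖ ^ 2) (x := 0) (y := w)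
    (fun x _ => (hasDerivAt_elementaryFactor x).hasDerivWithinAt) ?_ (by simp) (by simp)
  · calc _ = ‖elementaryFactor w - elementaryFactor 0‖ := by simp [elementaryFactor]
      _ ≤ _ := h
      _ = _ := by simp; ring
  · intro x hx
    have hx : ‖x‖ ≤ ‖w‖ := by simpa using hx
    have h1 : ‖x + x ^ 2 / 2‖ ≤ 1 := by
      calc _ ≤ ‖x‖ + ‖x ^ 2 / 2‖ := norm_add_le _ _
        _ = ‖x‖ + ‖x‖ ^ 2 / 2 := by simp
        _ ≤ 1 := by nlinarith [norm_nonneg x]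
    have h2 : ‖Complex.exp (x + x ^ 2 / 2)‖ ≤ 3 := by
      rw [Complex.norm_exp]
      calc _ ≤ Real.exp 1 := Real.exp_le_exp.2 ((Complex.re_le_norm _).trans h1)
        _ ≤ 3 := Real.exp_one_lt_three.le
    rw [norm_mul, norm_neg, norm_pow, mul_comm]
    gcongr

lemma logDeriv_elementaryFactor {w : ℂ} (hw : w ≠ 1) :
    logDeriv elementaryFactor w = 1 / (w - 1) + 1 + w := by
  rw [logDeriv_apply, (hasDerivAt_elementaryFactor w).deriv, elementaryFactor]
  have := Complex.exp_ne_zero (w + w ^ 2 / 2)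
  have h1 : 1 - w ≠ 0 := sub_ne_zero.2 hw.symm
  have h2 : w - 1 ≠ 0 := sub_ne_zero.2 hw
  rw [mul_div_mul_right _ _ this]
  grind

variable (L : PeriodPair)

/-- The even entire function `σ(z) / z`. -/
def sigmaProd (z : ℂ) : ℂ := ∏' μ : {μ : L.lattice // μ ≠ 0}, elementaryFactor (z / (μ : ℂ))

lemma sigma_eq (z : ℂ) : sigma L z = z * sigmaProd L z := rfl

lemma summable_norm_inv_cube :
    Summable fun μ : {μ : L.lattice // μ ≠ 0} => (‖(μ : ℂ)‖ ^ 3)⁻¹ := by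
  have := ZLattice.summable_norm_rpow L.lattice (-3) (by simp; norm_num)
  refine (this.subtype {μ | μ ≠ 0}).congr fun μ => ?_
  simp

/-- All but finitely many `μ` satisfy `‖μ‖ > 2R`, because the terms of a summable family tend to
zero; for these the cubic bound applies to `z / μ`. -/
lemma eventually_norm_elementaryFactor_le {R : ℝ} (hR : 0 < R) :
    ∀ᶠ μ : {μ : L.lattice // μ ≠ 0} in cofinite, ∀ z : ℂ, ‖z‖ ≤ R →
      ‖elementaryFactor (z / (μ : ℂ)) - 1‖ ≤ 3 * R ^ 3 * (‖(μ : ℂ)‖ ^ 3)⁻¹ := by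
  have h := (summable_norm_inv_cube L).tendsto_cofinite_zero.eventually_lt_const
    (show (0 : ℝ) < ((2 * R) ^ 3)⁻¹ by positivity)
  filter_upwards [h] with μ hμ z hz
  have h0 : 0 < ‖(μ : ℂ)‖ := by
    have := μ.2
    simpa using this
  rw [inv_lt_inv₀ (by positivity) (by positivity)] at hμ
  have h1 : 2 * R < ‖(μ : ℂ)‖ := lt_of_pow_lt_pow_left₀ 3 h0.le hμ
  calc _ ≤ 3 * ‖z / (μ : ℂ)‖ ^ 3 := norm_elementaryFactor_sub_one_le (by
        rw [norm_div, div_le_iff₀ h0]; linarith)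
    _ ≤ 3 * (R / ‖(μ : ℂ)‖) ^ 3 := by rw [norm_div]; gcongr
    _ = _ := by rw [div_pow]; ring

lemma hasProdLocallyUniformlyOn_sigmaProd :
    HasProdLocallyUniformlyOn (fun (μ : {μ : L.lattice // μ ≠ 0}) z =>
      elementaryFactor (z / (μ : ℂ))) (sigmaProd L) Set.univ := by
  refine hasProdLocallyUniformlyOn_of_forall_compact isOpen_univ fun K _ hK => ?_
  obtain ⟨R, hR, hKR⟩ := hK.isBounded.exists_pos_norm_le
  have := Summable.hasProdUniformlyOn_one_add hK
    (f := fun (μ : {μ : L.lattice // μ ≠ 0}) z => elementaryFactor (z / (μ : ℂ)) - 1)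
    ((summable_norm_inv_cube L).mul_left (3 * R ^ 3))
    ((eventually_norm_elementaryFactor_le L hR).mono fun μ h z hz => h z (hKR z hz))
    (fun μ => Differentiable.continuous (𝕜 := ℂ) (by fun_prop) |>.continuousOn)
  simp only [add_sub_cancel] at this
  exact this

lemma differentiable_sigmaProd : Differentiable ℂ (sigmaProd L) := by
  rw [← differentiableOn_univ]
  refine TendstoLocallyUniformlyOn.differentiableOn (φ := atTop)
    (hasProdLocallyUniformlyOn_sigmaProd L) (.of_forall fun s => ?_) isOpen_univ
  fun_prop

lemma sigmaProd_ne_zero {z : ℂ} (hz : z ∉ L.lattice ∨ z = 0) : sigmaProd L z ≠ 0 := by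
  have key : ∏' μ : {μ : L.lattice // μ ≠ 0}, (1 + (elementaryFactor (z / (μ : ℂ)) - 1)) ≠ 0 := by
    refine tprod_one_add_ne_zero_of_summable (fun μ => ?_) ?_
    · have h0 : (μ : ℂ) ≠ 0 := by
        have := μ.2
        simpa using this
      rw [add_sub_cancel]
      refine elementaryFactor_ne_zero ?_
      rcases hz with hz | rfl
      · rw [Ne, div_eq_one_iff_eq h0]
        rintro rfl
        exact hz μ.1.2
      · simp
    · refine Summable.of_norm_bounded_eventually
        ((summable_norm_inv_cube L).mul_left (3 * (‖z‖ + 1) ^ 3)) ?_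
      filter_upwards [eventually_norm_elementaryFactor_le L (R := ‖z‖ + 1) (by positivity)]
        with μ h
      simpa using h z (by simp)
  simp only [add_sub_cancel] at key
  exact key

lemma sigmaProd_neg (z : ℂ) : sigmaProd L (-z) = sigmaProd L z := by
  let e : {μ : L.lattice // μ ≠ 0} ≃ {μ : L.lattice // μ ≠ 0} :=
    (Equiv.neg L.lattice).subtypeEquiv (by simp)
  rw [sigmaProd, ← e.tprod_eq]
  simp [e, sigmaProd]

lemma sigma_neg (z : ℂ) : sigma L (-z) = -sigma L z := by
  rw [sigma_eq, sigma_eq, sigmaProd_neg, neg_mul]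

@[fun_prop]
lemma differentiable_sigma : Differentiable ℂ (sigma L) :=
  differentiable_id.mul (differentiable_sigmaProd L)

lemma sigma_ne_zero {z : ℂ} (hz : z ∉ L.lattice) : sigma L z ≠ 0 :=
  mul_ne_zero (by rintro rfl; exact hz (zero_mem _)) (sigmaProd_ne_zero L (.inl hz))

end

/-! ### The zeta function and its quasi-periods -/

section

variable (L : PeriodPair)

lemma lattice_compl_mem_nhds {z : ℂ} (hz : z ∉ L.lattice) : (L.lattice : Set ℂ)ᶜ ∈ 𝓝 z :=
  L.isClosed_lattice.isOpen_compl.mem_nhds hz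

lemma deriv_logDeriv {f : ℂ → ℂ} (hf : Differentiable ℂ f) {z : ℂ} (hz : f z ≠ 0) :
    deriv (logDeriv f) z = (deriv (deriv f) z * f z - deriv f z * deriv f z) / f z ^ 2 := by
  have h : logDeriv f = fun z => deriv f z / f z := by
    ext; rfl
  rw [h, deriv_fun_div _ (hf z) hz]
  exact (hf.analyticAt z).deriv.differentiableAt

lemma logDeriv_elementaryFactor_div {w μ : ℂ} (hμ : μ ≠ 0) (hw : w ≠ μ) :
    logDeriv (fun w => elementaryFactor (w / μ)) w = 1 / (w - μ) + 1 / μ + w / μ ^ 2 := by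
  have h1 : w / μ ≠ 1 := by rwa [Ne, div_eq_one_iff_eq hμ]
  have h2 : w - μ ≠ 0 := sub_ne_zero.2 hw
  have h3 : w / μ - 1 ≠ 0 := sub_ne_zero.2 h1
  have := logDeriv_comp (f := elementaryFactor) (g := fun w => w / μ) (x := w)
    (differentiable_elementaryFactor _) (by fun_prop)
  rw [Function.comp_def] at this
  rw [this, logDeriv_elementaryFactor h1]
  simp only [deriv_div_const, deriv_id'']
  have h4 : w / μ - 1 = (w - μ) / μ := by field_simp
  rw [h4]
  field_simp

lemma deriv_logDeriv_prod_elementaryFactor (S : Finset {μ : L.lattice // μ ≠ 0}) {z : ℂ}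
    (hz : z ∉ L.lattice) :
    deriv (logDeriv fun w => ∏ μ ∈ S, elementaryFactor (w / (μ : ℂ))) z =
      ∑ μ ∈ S, (1 / (μ : ℂ) ^ 2 - 1 / (z - μ) ^ 2) := by
  have h0 (μ : {μ : L.lattice // μ ≠ 0}) : (μ : ℂ) ≠ 0 := by
    have := μ.2
    simpa using this
  have hne (μ : {μ : L.lattice // μ ≠ 0}) {w : ℂ} (hw : w ∉ L.lattice) : w ≠ μ := by
    rintro rfl; exact hw μ.1.2
  have h1 : (logDeriv fun w => ∏ μ ∈ S, elementaryFactor (w / (μ : ℂ))) =ᶠ[𝓝 z]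
      fun w => ∑ μ ∈ S, (1 / (w - μ) + 1 / (μ : ℂ) + w / (μ : ℂ) ^ 2) := by
    filter_upwards [lattice_compl_mem_nhds L hz] with w hw
    rw [logDeriv_prod]
    · exact Finset.sum_congr rfl fun μ _ => logDeriv_elementaryFactor_div (h0 μ) (hne μ hw)
    · exact fun μ _ => elementaryFactor_ne_zero (by
        rw [Ne, div_eq_one_iff_eq (h0 μ)]; exact hne μ hw)
    · exact fun μ _ => by fun_prop
  rw [h1.deriv_eq]
  refine HasDerivAt.deriv (HasDerivAt.fun_sum fun μ _ => ?_)
  have h2 : z - μ ≠ 0 := sub_ne_zero.2 (hne μ hz)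
  have h3 := ((((hasDerivAt_id z).sub_const (μ : ℂ)).inv h2).add_const (1 / (μ : ℂ))).add
    ((hasDerivAt_id z).div_const ((μ : ℂ) ^ 2))
  convert! h3 using 1
  · ext w; simp
  · simp; ring

lemma hasSum_neg_weierstrassPExcept_zero (z : ℂ) :
    HasSum (fun μ : {μ : L.lattice // μ ≠ 0} => 1 / (μ : ℂ) ^ 2 - 1 / (z - μ) ^ 2)
      (-℘[L - (0 : ℂ)] z) := by
  have h := (L.hasSum_weierstrassPExcept 0 z).neg
  have h2 := (hasSum_subtype_iff_of_support_subset (s := {μ : L.lattice | μ ≠ 0}) ?_).2 h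
  · refine Eq.mp (congrArg (HasSum · _) (funext fun μ : {μ : L.lattice // μ ≠ 0} => ?_)) h2
    have h0 : ((μ : L.lattice) : ℂ) ≠ 0 := by
      have := μ.2
      simpa using this
    rw [Function.comp_apply, if_neg h0]
    ring
  · intro μ hμ
    simp_all

/-- The finite products and their first two derivatives converge locally uniformly, so the second
logarithmic derivative, a rational expression in them, converges as well. For the finite products it
is a partial sum of the series for `-℘` without its term at `0`. -/
lemma deriv_logDeriv_sigmaProd {z : ℂ} (hz : z ∉ L.lattice) :
    deriv (logDeriv (sigmaProd L)) z = -℘[L - (0 : ℂ)] z := by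
  have hd (S : Finset {μ : L.lattice // μ ≠ 0}) :
      Differentiable ℂ fun w => ∏ μ ∈ S, elementaryFactor (w / (μ : ℂ)) := by fun_prop
  have h0 : TendstoLocallyUniformlyOn
      (fun (S : Finset {μ : L.lattice // μ ≠ 0}) w => ∏ μ ∈ S, elementaryFactor (w / (μ : ℂ)))
      (sigmaProd L) atTop Set.univ := hasProdLocallyUniformlyOn_sigmaProd L
  have h1 := h0.deriv (.of_forall fun S => (hd S).differentiableOn) isOpen_univ
  have h2 := h1.deriv (.of_forall fun S => fun w _ =>
    ((hd S).analyticAt w).deriv.differentiableAt.differentiableWithinAt) isOpen_univ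
  have hz0 := sigmaProd_ne_zero L (.inl hz)
  have t0 := h0.tendsto_at (Set.mem_univ z)
  have t1 := h1.tendsto_at (Set.mem_univ z)
  have t2 := h2.tendsto_at (Set.mem_univ z)
  have t := ((t2.mul t0).sub (t1.mul t1)).div (t0.pow 2) (pow_ne_zero 2 hz0)
  rw [← deriv_logDeriv (differentiable_sigmaProd L) hz0] at t
  refine tendsto_nhds_unique t ((hasSum_neg_weierstrassPExcept_zero L z).congr fun S => ?_)
  rw [← deriv_logDeriv_prod_elementaryFactor L S hz, deriv_logDeriv (hd S)]
  · rfl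
  · refine Finset.prod_ne_zero_iff.2 fun μ _ => elementaryFactor_ne_zero ?_
    have hμ : (μ : ℂ) ≠ 0 := by
      have := μ.2
      simpa using this
    rw [Ne, div_eq_one_iff_eq hμ]
    rintro rfl
    exact hz μ.1.2

/-- The Weierstrass zeta function, the logarithmic derivative of `σ`. -/
def zeta : ℂ → ℂ := logDeriv (sigma L)

lemma analyticAt_zeta {z : ℂ} (hz : z ∉ L.lattice) : AnalyticAt ℂ (zeta L) z :=
  ((differentiable_sigma L).analyticAt z).deriv.div ((differentiable_sigma L).analyticAt z)
    (sigma_ne_zero L hz)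

lemma zeta_neg (z : ℂ) : zeta L (-z) = -zeta L z := by
  have h : deriv (sigma L) (-z) = deriv (sigma L) z := by
    have h1 := deriv_comp_neg (sigma L) z
    have h2 : (fun x => sigma L (-x)) = fun x => -sigma L x := funext (sigma_neg L)
    rw [h2, deriv.fun_neg] at h1
    exact (neg_injective h1).symm
  simp only [zeta, logDeriv_apply, h, sigma_neg, div_neg]

lemma deriv_zeta {z : ℂ} (hz : z ∉ L.lattice) : deriv (zeta L) z = -℘[L] z := by
  have hne {w : ℂ} (hw : w ∉ L.lattice) : w ≠ 0 := by rintro rfl; exact hw (zero_mem _)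
  have h1 : zeta L =ᶠ[𝓝 z] fun w => w⁻¹ + logDeriv (sigmaProd L) w := by
    filter_upwards [lattice_compl_mem_nhds L hz] with w hw
    have h2 := logDeriv_mul (f := fun w => w) (g := sigmaProd L) w (hne hw)
      (sigmaProd_ne_zero L (.inl hw)) differentiableAt_fun_id (differentiable_sigmaProd L w)
    rw [zeta, show sigma L = fun w => w * sigmaProd L w from rfl, h2]
    simp [logDeriv_apply]
  have hd : DifferentiableAt ℂ (logDeriv (sigmaProd L)) z :=
    (((differentiable_sigmaProd L).analyticAt z).deriv.div
      ((differentiable_sigmaProd L).analyticAt z) (sigmaProd_ne_zero L (.inl hz))).differentiableAt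
  rw [h1.deriv_eq, deriv_fun_add (differentiableAt_inv (hne hz)) hd, deriv_logDeriv_sigmaProd L hz]
  have := L.weierstrassPExcept_def 0 z
  simp only [ZeroMemClass.coe_zero] at this
  rw [this]
  simp

/-- The difference has derivative zero by periodicity of `℘`, and the complement of a countable set
in the plane is connected. -/
lemma exists_zeta_add_eq (ω : L.lattice) :
    ∃ η : ℂ, ∀ z ∉ L.lattice, zeta L (z + ω) = zeta L z + η := by
  have hmem {z : ℂ} : z + ω ∈ L.lattice ↔ z ∈ L.lattice :=
    ⟨fun h => by simpa using sub_mem h ω.2, fun h => add_mem h ω.2⟩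
  have hconn : IsPreconnected (L.lattice : Set ℂ)ᶜ :=
    (Set.Countable.isConnected_compl_of_one_lt_rank (by simp)
      (countable_of_Lindelof_of_discrete (X := L.lattice))).2
  have hd {z : ℂ} (hz : z ∉ L.lattice) : DifferentiableAt ℂ (zeta L) z :=
    (analyticAt_zeta L hz).differentiableAt
  have hd' {z : ℂ} (hz : z ∉ L.lattice) : DifferentiableAt ℂ (fun z => zeta L (z + ω)) z :=
    (hd (mt hmem.1 hz)).comp (f := fun z => z + (ω : ℂ)) z (by fun_prop)
  obtain ⟨η, hη⟩ := L.isClosed_lattice.isOpen_compl.exists_is_const_of_deriv_eq_zero hconn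
    (f := fun z => zeta L (z + ω) - zeta L z)
    (fun z hz => ((hd' hz).sub (hd hz)).differentiableWithinAt) (fun z hz => by
      rw [deriv_fun_sub (hd' hz) (hd hz), deriv_comp_add_const, deriv_zeta L hz,
        deriv_zeta L (mt hmem.1 hz)]
      simp)
  exact ⟨η, fun z hz => by rw [← hη z hz]; ring⟩

lemma exists_zeta_add_nsmul_eq (ω : L.lattice) :
    ∃ η : ℂ, ∀ (n : ℕ), ∀ z ∉ L.lattice, zeta L (z + n * ω) = zeta L z + n * η := by
  obtain ⟨η, hη⟩ := exists_zeta_add_eq L ω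
  refine ⟨η, fun n z hz => ?_⟩
  induction n with
  | zero => simp
  | succ n ih =>
    have h : z + n * ω ∉ L.lattice := fun h => hz (by
      have h2 : (n : ℂ) * ω ∈ L.lattice := by
        simpa using nsmul_mem ω.2 n
      simpa using sub_mem h h2)
    have := hη _ h
    rw [ih] at this
    push_cast
    rw [show z + (n + 1) * (ω : ℂ) = z + n * ω + ω by ring, this]
    ring

end

/-! ### Sums over division points and the distribution relation -/

section

variable (L : PeriodPair)

/-- The `N`-division point `(x ω₁ + y ω₂) / N` of `L`. -/
def divisionPoint (N : ℕ) (x y : ℤ) : ℂ := ((x : ℂ) * L.ω₁ + (y : ℂ) * L.ω₂) / N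

lemma natCast_mul_mem {z : ℂ} (n : ℕ) (hz : z ∈ L.lattice) : (n : ℂ) * z ∈ L.lattice := by
  simpa using nsmul_mem hz n

lemma divisionPoint_mem_lattice {N : ℕ} (hN : N ≠ 0) {x y : ℤ} :
    divisionPoint L N x y ∈ L.lattice ↔ (N : ℤ) ∣ x ∧ (N : ℤ) ∣ y := by
  have hN' : (N : ℂ) ≠ 0 := by exact_mod_cast hN
  rw [mem_lattice]
  constructor
  · rintro ⟨m, n, h⟩
    rw [divisionPoint, eq_div_iff hN'] at h
    have := LinearIndependent.pair_iff.mp L.indep (m * N - x) (n * N - y)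
      (by simp; linear_combination h)
    simp only [sub_eq_zero] at this
    norm_cast at this
    exact ⟨⟨m, by rw [← this.1, mul_comm]⟩, ⟨n, by rw [← this.2, mul_comm]⟩⟩
  · rintro ⟨⟨m, rfl⟩, ⟨n, rfl⟩⟩
    refine ⟨m, n, ?_⟩
    rw [divisionPoint]
    push_cast
    field_simp

lemma mul_divisionPoint (N : ℕ) (u x y : ℤ) :
    (u : ℂ) * divisionPoint L N x y = divisionPoint L N (u * x) (u * y) := by
  simp only [divisionPoint]
  push_cast
  ring

lemma divisionPoint_congr {N : ℕ} (hN : N ≠ 0) {f : ℂ → ℂ}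
    (hf : ∀ z, ∀ l ∈ L.lattice, f (z + l) = f z) {x y x' y' : ℤ}
    (hx : (x : ZMod N) = x') (hy : (y : ZMod N) = y') :
    f (divisionPoint L N x y) = f (divisionPoint L N x' y') := by
  rw [ZMod.intCast_eq_intCast_iff_dvd_sub] at hx hy
  rw [← hf _ _ ((divisionPoint_mem_lattice L hN).2 ⟨hx, hy⟩)]
  congr 1
  simp only [divisionPoint]
  push_cast
  ring

/-- The pairs `(d₁, d₂)` that index the nonzero classes of `N⁻¹L / L`. -/
def nonzeroIndices (N : ℕ) : Finset (ℕ × ℕ) := (Finset.range N ×ˢ Finset.range N).erase (0, 0)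

lemma sum_nonzeroIndices {N : ℕ} [NeZero N] (g : ZMod N × ZMod N → ℂ) :
    ∑ d ∈ nonzeroIndices N, g (d.1, d.2) = ∑ a ∈ Finset.univ.erase 0, g a := by
  refine Finset.sum_nbij' (fun d => ((d.1 : ZMod N), (d.2 : ZMod N)))
    (fun a => (a.1.val, a.2.val)) ?_ ?_ ?_ ?_ ?_
  · rintro ⟨x, y⟩ h
    simp only [nonzeroIndices, Finset.mem_erase, Finset.mem_product, Finset.mem_range, ne_eq,
      Prod.mk.injEq] at h
    simp only [Finset.mem_erase, Finset.mem_univ, and_true, ne_eq, Prod.mk_eq_zero,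
      ZMod.natCast_eq_zero_iff]
    rintro ⟨h1, h2⟩
    exact h.1 ⟨Nat.eq_zero_of_dvd_of_lt h1 h.2.1, Nat.eq_zero_of_dvd_of_lt h2 h.2.2⟩
  · rintro ⟨x, y⟩ h
    simp_all [nonzeroIndices, ZMod.val_lt]
  · rintro ⟨x, y⟩ h
    simp only [nonzeroIndices, Finset.mem_erase, Finset.mem_product, Finset.mem_range] at h
    simp [ZMod.val_natCast, Nat.mod_eq_of_lt h.2.1, Nat.mod_eq_of_lt h.2.2]
  · rintro ⟨x, y⟩ h
    simp
  · rintro ⟨x, y⟩ h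
    rfl

/-- A periodic function factors through `(ℤ/N)²`, where multiplication by the unit `u` permutes the
nonzero pairs. -/
lemma sum_mul_divisionPoint {N : ℕ} (hN : N ≠ 0) {f : ℂ → ℂ}
    (hf : ∀ z, ∀ l ∈ L.lattice, f (z + l) = f z) {u : ℤ} (hu : IsCoprime u N) :
    ∑ d ∈ nonzeroIndices N, f (u * divisionPoint L N d.1 d.2) =
      ∑ d ∈ nonzeroIndices N, f (divisionPoint L N d.1 d.2) := by
  have : NeZero N := ⟨hN⟩
  obtain ⟨v, w, hvw⟩ := hu
  have huv : (v : ZMod N) * u = 1 := by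
    have := congrArg (Int.cast : ℤ → ZMod N) hvw
    simpa using this
  let g : ZMod N × ZMod N → ℂ := fun a => f (divisionPoint L N a.1.val a.2.val)
  have hg (x y : ℤ) : f (divisionPoint L N x y) = g (x, y) :=
    divisionPoint_congr L hN hf (by simp) (by simp)
  calc _ = ∑ d ∈ nonzeroIndices N, (fun a : ZMod N × ZMod N => g (u * a.1, u * a.2)) (d.1, d.2) :=
        Finset.sum_congr rfl fun d _ => by
          rw [mul_divisionPoint, hg]
          simp
    _ = ∑ a ∈ Finset.univ.erase (0 : ZMod N × ZMod N), g (u * a.1, u * a.2) :=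
        sum_nonzeroIndices (fun a : ZMod N × ZMod N => g (u * a.1, u * a.2))
    _ = ∑ a ∈ Finset.univ.erase (0 : ZMod N × ZMod N), g a := by
        refine Finset.sum_nbij' (fun a => (u * a.1, u * a.2)) (fun a => (v * a.1, v * a.2))
          ?_ ?_ ?_ ?_ ?_
        · rintro ⟨x, y⟩ h
          simp only [Finset.mem_erase, Finset.mem_univ, and_true, ne_eq, Prod.mk_eq_zero] at h ⊢
          rintro ⟨h1, h2⟩
          exact h ⟨by rw [← one_mul x, ← huv, mul_assoc, h1, mul_zero],
            by rw [← one_mul y, ← huv, mul_assoc, h2, mul_zero]⟩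
        · rintro ⟨x, y⟩ h
          simp only [Finset.mem_erase, Finset.mem_univ, and_true, ne_eq, Prod.mk_eq_zero] at h ⊢
          rw [mul_comm] at huv
          rintro ⟨h1, h2⟩
          exact h ⟨by rw [← one_mul x, ← huv, mul_assoc, h1, mul_zero],
            by rw [← one_mul y, ← huv, mul_assoc, h2, mul_zero]⟩
        · rintro ⟨x, y⟩ -
          simp [← mul_assoc, huv]
        · rintro ⟨x, y⟩ -
          simp [← mul_assoc, mul_comm _ (v : ZMod N), huv]
        · rintro ⟨x, y⟩ -
          rfl
    _ = ∑ d ∈ nonzeroIndices N, g (d.1, d.2) := (sum_nonzeroIndices g).symm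
    _ = _ := Finset.sum_congr rfl fun d _ => by
          rw [hg]
          simp

lemma hasSum_derivWeierstrassP_int (z : ℂ) :
    HasSum (fun p : ℤ × ℤ => -2 / (z + (p.1 * L.ω₁ + p.2 * L.ω₂)) ^ 3) (℘'[L] z) := by
  have h := L.hasSum_derivWeierstrassP z
  -- Reindexing by `l ↦ -l` turns `z - l` into `z + l`.
  rw [← (L.latticeEquivProd.symm.toEquiv.trans (Equiv.neg L.lattice)).hasSum_iff] at h
  convert! h using 2 with p
  simp only [Function.comp_apply, Equiv.trans_apply, Equiv.neg_apply, LinearEquiv.coe_toEquiv,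
    NegMemClass.coe_neg, latticeEquiv_symm_apply, sub_neg_eq_add]

/-- Dividing both coordinates of a lattice vector by `N` with remainder writes `Nz + l` as `N(z + ρ
+ l')`. Unconditional summability allows regrouping the series of `℘'(Nz)` by residue classes. -/
lemma sum_derivWeierstrassP_add_divisionPoint {N : ℕ} (hN : N ≠ 0) (z : ℂ) :
    ∑ d ∈ Finset.range N ×ˢ Finset.range N, ℘'[L] (z + divisionPoint L N d.1 d.2) =
      (N : ℂ) ^ 3 * ℘'[L] (N * z) := by
  have : NeZero N := ⟨hN⟩
  have hN' : (N : ℂ) ≠ 0 := by exact_mod_cast hN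
  let e : ℤ × ℤ ≃ (Fin N × Fin N) × (ℤ × ℤ) :=
    ((Int.divModEquiv N).prodCongr (Int.divModEquiv N)).trans
      ((Equiv.prodProdProdComm _ _ _ _).trans (Equiv.prodComm _ _))
  have h := (hasSum_derivWeierstrassP_int L (N * z)).mul_left ((N : ℂ) ^ 3)
  rw [← e.symm.hasSum_iff] at h
  have h2 := h.prod_fiberwise (g := fun b : Fin N × Fin N =>
    ℘'[L] (z + divisionPoint L N (b.1 : ℕ) (b.2 : ℕ))) fun b => by
    convert! hasSum_derivWeierstrassP_int L
      (z + divisionPoint L N (b.1 : ℕ) (b.2 : ℕ)) using 2 with p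
    have he : e.symm (b, p) = (p.1 * N + (b.1 : ℕ), p.2 * N + (b.2 : ℕ)) := rfl
    have h1 : (N : ℂ) * z + (((p.1 * N + (b.1 : ℕ) : ℤ) : ℂ) * L.ω₁ +
        ((p.2 * N + (b.2 : ℕ) : ℤ) : ℂ) * L.ω₂) =
        N * (z + divisionPoint L N (b.1 : ℕ) (b.2 : ℕ) + (p.1 * L.ω₁ + p.2 * L.ω₂)) := by
      rw [divisionPoint]
      push_cast
      field_simp
      ring
    rw [Function.comp_apply, he, h1, mul_pow, ← mul_div_assoc,
      mul_div_mul_left _ _ (pow_ne_zero 3 hN')]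
  have h3 := (hasSum_fintype _).unique h2
  rw [← h3, Fintype.sum_prod_type, Finset.sum_product, Finset.sum_range]
  refine Finset.sum_congr rfl fun i _ => ?_
  rw [Finset.sum_range]

end

/-! ### Logarithmic derivatives of theta and of its translates -/

section

variable (L : PeriodPair)

/-- Real independence of the periods makes their ratio non-real, so the ratio used in either case
lies in the upper half-plane, where `η` has no zeros. -/
lemma latticeDelta_ne_zero : latticeDelta L ≠ 0 := by
  have h1 : L.ω₁ ≠ 0 := L.indep.ne_zero 0
  have h2 : L.ω₂ ≠ 0 := L.indep.ne_zero 1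
  have hpi : (2 * Real.pi * Complex.I : ℂ) ≠ 0 := Complex.two_pi_I_ne_zero
  have him : (L.ω₁ / L.ω₂).im ≠ 0 := fun h => by
    have h3 : L.ω₁ / L.ω₂ = ((L.ω₁ / L.ω₂).re : ℂ) := Complex.ext rfl (by simpa using h)
    rw [div_eq_iff h2] at h3
    have := LinearIndependent.pair_iff.mp L.indep 1 (-(L.ω₁ / L.ω₂).re)
      (by simp only [one_smul, neg_smul, Complex.real_smul]; linear_combination h3)
    simp at this
  rw [latticeDelta]
  split_ifs with h
  · exact mul_ne_zero (inv_ne_zero (pow_ne_zero _ (div_ne_zero h2 hpi)))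
      (pow_ne_zero _ (ModularForm.eta_ne_zero h))
  · refine mul_ne_zero (inv_ne_zero (pow_ne_zero _ (div_ne_zero h1 hpi)))
      (pow_ne_zero _ (ModularForm.eta_ne_zero ?_))
    have h4 : (L.ω₁ / L.ω₂).im < 0 := lt_of_le_of_ne (not_lt.1 h) him
    change 0 < (L.ω₂ / L.ω₁).im
    rw [← inv_div, Complex.inv_im]
    exact div_pos (neg_pos.2 h4) (Complex.normSq_pos.2 (div_ne_zero h1 h2))

lemma theta_ne_zero {z : ℂ} (hz : z ∉ L.lattice) : theta L z ≠ 0 :=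
  mul_ne_zero (mul_ne_zero (latticeDelta_ne_zero L) (Complex.exp_ne_zero _))
    (pow_ne_zero _ (sigma_ne_zero L hz))

@[fun_prop]
lemma differentiable_theta : Differentiable ℂ (theta L) := by
  unfold theta
  fun_prop

lemma logDeriv_theta {z : ℂ} (hz : z ∉ L.lattice) :
    logDeriv (theta L) z = 12 * zeta L z - 12 * s₂ L * z := by
  have h : theta L = fun z => latticeDelta L * (Complex.exp (-6 * s₂ L * z ^ 2) *
      sigma L z ^ 12) := by
    ext z
    rw [theta, mul_assoc]
  have hexp : HasDerivAt (fun z => Complex.exp (-6 * s₂ L * z ^ 2))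
      (Complex.exp (-6 * s₂ L * z ^ 2) * (-6 * s₂ L * (2 * z))) z := by
    have := ((hasDerivAt_pow 2 z).const_mul (-6 * s₂ L)).cexp
    simpa using this
  rw [h, logDeriv_const_mul _ _ (latticeDelta_ne_zero L),
    logDeriv_mul (f := fun z => Complex.exp (-6 * s₂ L * z ^ 2)) (g := fun z => sigma L z ^ 12) _
      (Complex.exp_ne_zero _) (pow_ne_zero _ (sigma_ne_zero L hz)) (by fun_prop)
      (by fun_prop), logDeriv_fun_pow (by fun_prop), logDeriv_apply, hexp.deriv,
    mul_div_cancel_left₀ _ (Complex.exp_ne_zero _), zeta]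
  push_cast
  ring

/-- The elliptic function `c² ζ(z) - c ζ(cz)`. -/
def zetaDiff (c : ℕ) (z : ℂ) : ℂ := (c : ℂ) ^ 2 * zeta L z - c * zeta L (c * z)

lemma analyticAt_Theta (c : ℕ) {z : ℂ} (hcz : (c : ℂ) * z ∉ L.lattice) :
    AnalyticAt ℂ (Theta c L) z := by
  have h1 : Differentiable ℂ fun z => theta L z ^ (c ^ 2) := by fun_prop
  have h2 : Differentiable ℂ fun z => theta L (c * z) := by fun_prop
  exact (h1.analyticAt z).div (h2.analyticAt z) (theta_ne_zero L hcz)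

lemma notMem_of_natCast_mul_notMem {c : ℕ} {z : ℂ} (hcz : (c : ℂ) * z ∉ L.lattice) :
    z ∉ L.lattice := mt (natCast_mul_mem L c) hcz

lemma Theta_ne_zero {c : ℕ} {z : ℂ} (hcz : (c : ℂ) * z ∉ L.lattice) : Theta c L z ≠ 0 :=
  div_ne_zero (pow_ne_zero _ (theta_ne_zero L (notMem_of_natCast_mul_notMem L hcz)))
    (theta_ne_zero L hcz)

lemma logDeriv_Theta {c : ℕ} {z : ℂ} (hcz : (c : ℂ) * z ∉ L.lattice) :
    logDeriv (Theta c L) z = 12 * zetaDiff L c z := by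
  have hz := notMem_of_natCast_mul_notMem L hcz
  have h := logDeriv_comp (f := theta L) (g := fun z => (c : ℂ) * z) (x := z)
    (by fun_prop) (by fun_prop)
  rw [Function.comp_def] at h
  unfold Theta
  rw [logDeriv_div (f := fun z => theta L z ^ (c ^ 2)) (g := fun z => theta L (c * z)) _ (pow_ne_zero _ (theta_ne_zero L hz)) (theta_ne_zero L hcz) (by fun_prop)
    (by fun_prop), logDeriv_fun_pow (by fun_prop), h, logDeriv_theta L hz, logDeriv_theta L hcz]
  simp only [deriv_const_mul_id', zetaDiff]
  push_cast
  ring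

lemma analyticAt_zetaDiff {c : ℕ} {z : ℂ} (hcz : (c : ℂ) * z ∉ L.lattice) :
    AnalyticAt ℂ (zetaDiff L c) z := by
  have h1 := analyticAt_zeta L (notMem_of_natCast_mul_notMem L hcz)
  have h2 : AnalyticAt ℂ (fun z => zeta L (c * z)) z :=
    (analyticAt_zeta L hcz).fun_comp (by fun_prop)
  unfold zetaDiff
  fun_prop

lemma zetaDiff_neg (c : ℕ) (z : ℂ) : zetaDiff L c (-z) = -zetaDiff L c z := by
  simp only [zetaDiff, mul_neg, zeta_neg]
  ring

/-- If `η` is the quasi-period of `l`, the first term changes by `c² η` and the second by `c · (c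
η)`. -/
lemma zetaDiff_add {c : ℕ} {z : ℂ} (hcz : (c : ℂ) * z ∉ L.lattice) {l : ℂ} (hl : l ∈ L.lattice) :
    zetaDiff L c (z + l) = zetaDiff L c z := by
  obtain ⟨η, hη⟩ := exists_zeta_add_nsmul_eq L ⟨l, hl⟩
  have h1 := hη 1 z (notMem_of_natCast_mul_notMem L hcz)
  have h2 := hη c _ hcz
  simp only [Nat.cast_one, one_mul] at h1
  rw [zetaDiff, h1, mul_add (c : ℂ) z l, h2, zetaDiff]
  ring

lemma deriv_zetaDiff {c : ℕ} {z : ℂ} (hcz : (c : ℂ) * z ∉ L.lattice) :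
    deriv (zetaDiff L c) z = (c : ℂ) ^ 2 * (℘[L] (c * z) - ℘[L] z) := by
  have hz := notMem_of_natCast_mul_notMem L hcz
  have h1 := (analyticAt_zeta L hz).differentiableAt.hasDerivAt
  have h2 := (analyticAt_zeta L hcz).differentiableAt.hasDerivAt
  rw [deriv_zeta L hz] at h1
  rw [deriv_zeta L hcz] at h2
  have h3 := h2.comp z (h := fun z => (c : ℂ) * z) ((hasDerivAt_id z).const_mul (c : ℂ))
  have h4 := (h1.const_mul ((c : ℂ) ^ 2)).sub (h3.const_mul (c : ℂ))
  refine (HasDerivAt.congr_deriv h4 ?_).deriv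
  ring

section DivisionPoints

variable {c N : ℕ}

lemma mul_divisionPoint_notMem (hN : 1 < N) (hcN : Nat.Coprime c N) {d : ℕ × ℕ}
    (hd : d ∈ nonzeroIndices N) : (c : ℂ) * divisionPoint L N d.1 d.2 ∉ L.lattice := by
  have h := mul_divisionPoint L N c d.1 d.2
  rw [Int.cast_natCast] at h
  rw [h, divisionPoint_mem_lattice L (by omega)]
  simp only [nonzeroIndices, Finset.mem_erase, Finset.mem_product, Finset.mem_range, ne_eq,
    Prod.ext_iff] at hd
  rintro ⟨h1, h2⟩
  norm_cast at h1 h2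
  exact hd.1 ⟨Nat.eq_zero_of_dvd_of_lt (hcN.symm.dvd_of_dvd_mul_left h1) hd.2.1,
    Nat.eq_zero_of_dvd_of_lt (hcN.symm.dvd_of_dvd_mul_left h2) hd.2.2⟩

lemma eventually_mul_add_divisionPoint_notMem (hN : 1 < N) (hcN : Nat.Coprime c N) :
    ∀ᶠ z in 𝓝 (0 : ℂ), ∀ d ∈ nonzeroIndices N,
      (c : ℂ) * (z + divisionPoint L N d.1 d.2) ∉ L.lattice := by
  rw [eventually_all_finset]
  intro d hd
  have hc : Continuous fun z : ℂ => (c : ℂ) * (z + divisionPoint L N d.1 d.2) := by fun_prop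
  refine hc.continuousAt.eventually (lattice_compl_mem_nhds L ?_)
  simp only [zero_add]
  exact mul_divisionPoint_notMem L hN hcN hd

lemma Lam_eq (c N : ℕ) :
    Lam c N L = fun z => ∏ d ∈ nonzeroIndices N, Theta c L (z + divisionPoint L N d.1 d.2) := by
  ext z
  simp [Lam, nonzeroIndices, divisionPoint]

lemma analyticAt_Lam (hN : 1 < N) (hcN : Nat.Coprime c N) : AnalyticAt ℂ (Lam c N L) 0 := by
  rw [Lam_eq]
  refine Finset.analyticAt_fun_prod _ fun d hd => ?_
  refine AnalyticAt.fun_comp (g := Theta c L) ?_ (by fun_prop)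
  refine analyticAt_Theta L c ?_
  rw [zero_add]
  exact mul_divisionPoint_notMem L hN hcN hd

lemma Lam_ne_zero (hN : 1 < N) (hcN : Nat.Coprime c N) : Lam c N L 0 ≠ 0 := by
  rw [Lam_eq]
  refine Finset.prod_ne_zero_iff.2 fun d hd => Theta_ne_zero L ?_
  rw [zero_add]
  exact mul_divisionPoint_notMem L hN hcN hd

/-- The sum of the translates of `c² ζ(z) - c ζ(cz)` by the nonzero `N`-division points. -/
def zetaDiffSum (c N : ℕ) (z : ℂ) : ℂ :=
  ∑ d ∈ nonzeroIndices N, zetaDiff L c (z + divisionPoint L N d.1 d.2)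

lemma logDeriv_Lam (hN : 1 < N) (hcN : Nat.Coprime c N) :
    logDeriv (Lam c N L) =ᶠ[𝓝 0] fun z => 12 * zetaDiffSum L c N z := by
  filter_upwards [eventually_mul_add_divisionPoint_notMem L hN hcN] with z hz
  rw [Lam_eq, logDeriv_prod
    (f := fun (d : ℕ × ℕ) z => Theta c L (z + divisionPoint L N d.1 d.2))
    (fun d hd => Theta_ne_zero L (hz d hd)), zetaDiffSum, Finset.mul_sum]
  · refine Finset.sum_congr rfl fun d hd => ?_
    rw [← logDeriv_Theta L (hz d hd), logDeriv_apply, logDeriv_apply,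
      deriv_comp_add_const]
  · exact fun d hd => ((analyticAt_Theta L c (hz d hd)).fun_comp
      (f := fun z => z + divisionPoint L N d.1 d.2) (by fun_prop)).differentiableAt

lemma zetaDiffSum_zero (hN : 1 < N) (hcN : Nat.Coprime c N) : zetaDiffSum L c N 0 = 0 := by
  classical
  -- Setting the value to `0` at the possible poles makes periodicity and oddness hold at every
  -- point, as the permutation lemma demands.
  let f : ℂ → ℂ := fun z => if (c : ℂ) * z ∈ L.lattice then 0 else zetaDiff L c z
  have hf : ∀ z, ∀ l ∈ L.lattice, f (z + l) = f z := by
    intro z l hl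
    have h1 : (c : ℂ) * (z + l) ∈ L.lattice ↔ (c : ℂ) * z ∈ L.lattice := by
      rw [mul_add, Submodule.add_mem_iff_left _ (natCast_mul_mem L c hl)]
    by_cases h : (c : ℂ) * z ∈ L.lattice
    · simp only [f, h1, h, if_true]
    · simp only [f, h1, h, if_false, zetaDiff_add L h hl]
  have hneg (z : ℂ) : f (-z) = -f z := by
    simp only [f, mul_neg, neg_mem_iff, zetaDiff_neg]
    split_ifs <;> simp
  have h1 : zetaDiffSum L c N 0 = ∑ d ∈ nonzeroIndices N, f (divisionPoint L N d.1 d.2) :=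
    Finset.sum_congr rfl fun d hd => by
      simp only [f, if_neg (mul_divisionPoint_notMem L hN hcN hd), zero_add]
  have h2 := sum_mul_divisionPoint L (by omega) hf (u := -1)
    (show IsCoprime (-1 : ℤ) (N : ℤ) from isCoprime_one_left.neg_left)
  simp only [Int.cast_neg, Int.cast_one, neg_mul, one_mul, hneg, Finset.sum_neg_distrib,
    ← h1] at h2
  exact CharZero.eq_neg_self_iff.1 h2.symm

lemma deriv_zetaDiffSum (hN : 1 < N) (hcN : Nat.Coprime c N) :
    deriv (zetaDiffSum L c N) =ᶠ[𝓝 0] fun z => ∑ d ∈ nonzeroIndices N,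
      (c : ℂ) ^ 2 * (℘[L] (c * (z + divisionPoint L N d.1 d.2)) -
        ℘[L] (z + divisionPoint L N d.1 d.2)) := by
  filter_upwards [eventually_mul_add_divisionPoint_notMem L hN hcN] with z hz
  unfold zetaDiffSum
  rw [deriv_fun_sum]
  · exact Finset.sum_congr rfl fun d hd => by
      rw [deriv_comp_add_const, deriv_zetaDiff L (hz d hd)]
  · exact fun d hd => ((analyticAt_zetaDiff L (hz d hd)).fun_comp
      (f := fun z => z + divisionPoint L N d.1 d.2) (by fun_prop)).differentiableAt

lemma deriv_zetaDiffSum_zero (hN : 1 < N) (hcN : Nat.Coprime c N) :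
    deriv (zetaDiffSum L c N) 0 = 0 := by
  have h := sum_mul_divisionPoint L (f := ℘[L]) (by omega)
    (fun z l hl => L.weierstrassP_add_coe z ⟨l, hl⟩)
    (show IsCoprime (c : ℤ) (N : ℤ) from Nat.isCoprime_iff_coprime.2 hcN)
  rw [Int.cast_natCast] at h
  rw [(deriv_zetaDiffSum L hN hcN).self_of_nhds]
  simp only [zero_add]
  rw [← Finset.mul_sum, Finset.sum_sub_distrib]
  rw [h, sub_self, mul_zero]

lemma sum_nonzeroIndices_derivWeierstrassP (hN : 1 < N) (z : ℂ) :
    ∑ d ∈ nonzeroIndices N, ℘'[L] (z + divisionPoint L N d.1 d.2) =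
      (N : ℂ) ^ 3 * ℘'[L] (N * z) - ℘'[L] z := by
  rw [← sum_derivWeierstrassP_add_divisionPoint L (by omega), nonzeroIndices,
    ← Finset.sum_erase_add (Finset.range N ×ˢ Finset.range N) _ (a := (0, 0))]
  · simp [divisionPoint]
  · simp; omega

lemma deriv_deriv_zetaDiffSum (hN : 1 < N) (hcN : Nat.Coprime c N) :
    deriv (deriv (zetaDiffSum L c N)) =ᶠ[𝓝 0] fun z =>
      (c : ℂ) ^ 3 * ((N : ℂ) ^ 3 * ℘'[L] (N * (c * z)) - ℘'[L] (c * z)) -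
        (c : ℂ) ^ 2 * ((N : ℂ) ^ 3 * ℘'[L] (N * z) - ℘'[L] z) := by
  filter_upwards [eventually_mul_add_divisionPoint_notMem L hN hcN,
    (deriv_zetaDiffSum L hN hcN).eventually_nhds] with z hz hz'
  -- For fixed `z`, the function `w ↦ ℘'(cz + w)` is periodic, so `cρ` may be replaced by `ρ` in the
  -- sum.
  have h1 := sum_mul_divisionPoint L (f := fun w => ℘'[L] (c * z + w)) (by omega)
    (fun w l hl => by rw [← add_assoc]; exact L.derivWeierstrassP_add_coe _ ⟨l, hl⟩)
    (show IsCoprime (c : ℤ) (N : ℤ) from Nat.isCoprime_iff_coprime.2 hcN)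
  rw [← sum_nonzeroIndices_derivWeierstrassP L hN, ← sum_nonzeroIndices_derivWeierstrassP L hN,
    ← h1, EventuallyEq.deriv_eq hz', Finset.mul_sum, Finset.mul_sum, ← Finset.sum_sub_distrib]
  refine (HasDerivAt.fun_sum fun d hd => ?_).deriv
  have hP {w : ℂ} (hw : w ∉ L.lattice) : HasDerivAt ℘[L] (℘'[L] w) w := by
    have := (L.analyticOnNhd_weierstrassP w hw).differentiableAt.hasDerivAt
    rwa [L.deriv_weierstrassP] at this
  have h2 := hP (hz d hd)
  have h3 := hP (notMem_of_natCast_mul_notMem L (hz d hd))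
  have h4 := (hasDerivAt_id z).add_const (divisionPoint L N d.1 d.2)
  have h5 := ((h2.comp z (h := fun z => (c : ℂ) * (z + divisionPoint L N d.1 d.2))
    (h4.const_mul (c : ℂ))).sub (h3.comp z h4)).const_mul ((c : ℂ) ^ 2)
  refine HasDerivAt.congr_deriv h5 ?_
  rw [mul_add, Int.cast_natCast]
  ring

end DivisionPoints

end

/-! ### Taylor coefficients of the logarithmic derivative -/

section

lemma iteratedDeriv_comp_mul_left (a : ℂ) (f : ℂ → ℂ) (k : ℕ) :
    iteratedDeriv k (fun z => f (a * z)) = fun z => a ^ k * iteratedDeriv k f (a * z) := by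
  induction k with
  | zero => simp
  | succ k ih =>
    ext z
    rw [iteratedDeriv_succ, ih, deriv_const_mul_field, deriv_comp_mul_left, iteratedDeriv_succ,
      smul_eq_mul, pow_succ, mul_assoc]

lemma contDiffAt_comp_mul_left {f : ℂ → ℂ} (hf : AnalyticAt ℂ f 0) (a : ℂ) (k : ℕ) :
    ContDiffAt ℂ k (fun z => f (a * z)) 0 :=
  (AnalyticAt.fun_comp_of_eq (f := fun z : ℂ => a * z) hf (by fun_prop) (by simp)).contDiffAt

variable (L : PeriodPair)

/-- The polar part `-2/w³` cancels inside each bracket, since `N³ · 2/(Nw)³ = 2/w³`. -/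
lemma deriv_deriv_zetaDiffSum_eq_derivWeierstrassPExcept {c N : ℕ} (hc : 1 < c) (hN : 1 < N)
    (hcN : Nat.Coprime c N) :
    deriv (deriv (zetaDiffSum L c N)) =ᶠ[𝓝 0] fun z =>
      (c : ℂ) ^ 3 * ((N : ℂ) ^ 3 * ℘'[L - (0 : ℂ)] ((N * c) * z) - ℘'[L - (0 : ℂ)] (c * z)) -
        (c : ℂ) ^ 2 * ((N : ℂ) ^ 3 * ℘'[L - (0 : ℂ)] (N * z) - ℘'[L - (0 : ℂ)] (1 * z)) := by
  refine (deriv_deriv_zetaDiffSum L hN hcN).trans (.of_forall fun z => ?_)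
  have h (w : ℂ) : ℘'[L] w = ℘'[L - (0 : ℂ)] w - 2 / w ^ 3 := by
    have := L.derivWeierstrassPExcept_sub 0 w
    simpa using this.symm
  have hc' : (c : ℂ) ≠ 0 := by norm_cast; omega
  have hN' : (N : ℂ) ≠ 0 := by norm_cast; omega
  simp only [h, one_mul, mul_assoc]
  rcases eq_or_ne z 0 with rfl | hz
  -- At the origin division by zero gives `0`, so the two sides agree there too.
  · simp
  · field_simp
    ring

lemma iteratedDeriv_zetaDiffSum {c N : ℕ} (hc : 1 < c) (hN : 1 < N) (hcN : Nat.Coprime c N)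
    (k : ℕ) :
    iteratedDeriv (k + 2) (zetaDiffSum L c N) 0 =
      ((k + 2).factorial : ℂ) * (((c : ℂ) ^ 2 - (c : ℂ) ^ (k + 3)) * (1 - (N : ℂ) ^ (k + 3)) *
        L.G (k + 3)) := by
  have hA (a : ℂ) := contDiffAt_comp_mul_left (L.analyticAt_derivWeierstrassPExcept 0) a k
  have hI (a : ℂ) : iteratedDeriv k (fun z => ℘'[L - (0 : ℂ)] (a * z)) 0 =
      a ^ k * (((k + 2).factorial : ℂ) * L.G (k + 3)) := by
    rw [iteratedDeriv_comp_mul_left]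
    dsimp only
    rw [mul_zero, L.iteratedDeriv_derivWeierstrassPExcept_self,
      L.sumInvPow_zero]
  rw [iteratedDeriv_succ', iteratedDeriv_succ',
    (deriv_deriv_zetaDiffSum_eq_derivWeierstrassPExcept L hc hN hcN).iteratedDeriv_eq]
  rw [iteratedDeriv_fun_sub, iteratedDeriv_const_mul_field, iteratedDeriv_const_mul_field,
    iteratedDeriv_fun_sub, iteratedDeriv_fun_sub, iteratedDeriv_const_mul_field,
    iteratedDeriv_const_mul_field, hI, hI, hI, hI]
  · ring
  all_goals
    have h1 := hA (N * c)
    have h2 := hA c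
    have h3 := hA N
    have h4 := hA 1
    fun_prop

lemma BH_div_factorial {n : ℕ} (hn : 3 ≤ n) : BH L n / (n.factorial : ℂ) = L.G n := by
  have hn' : (n.factorial : ℂ) ≠ 0 := by exact_mod_cast n.factorial_ne_zero
  rw [BH]
  split_ifs with h
  · rw [mul_div_cancel_left₀ _ hn', PeriodPair.G]
    -- The sum `G` runs over all of `L`, but its term at `0` is `0⁻¹ = 0`.
    refine tsum_subtype_eq_of_support_subset (s := {μ : L.lattice | μ ≠ 0})
      (f := fun μ : L.lattice => ((μ : ℂ) ^ n)⁻¹) fun μ hμ => ?_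
    rintro rfl
    exact hμ (by simp; omega)
  · rw [L.G_eq_zero_of_odd n, zero_div]
    rcases hn.eq_or_lt with rfl | hn
    · decide
    · exact Nat.not_even_iff_odd.1 fun h' => h ⟨hn, h'⟩

lemma BH_of_le_three {n : ℕ} (hn : n ≤ 3) : BH L n = 0 := if_neg (by omega)

theorem Fseries_eq {c N : ℕ} (hc : 1 < c) (hN : 1 < N) (hcN : Nat.Coprime c N) :
    Fseries c N L = PowerSeries.C (12 : ℂ) * PowerSeries.mk fun k : ℕ =>
        ((c : ℂ) ^ 2 - (c : ℂ) ^ (k + 1)) * (1 - (N : ℂ) ^ (k + 1)) *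
          (BH L (k + 1) / ((k + 1).factorial : ℂ)) := by
  ext k
  rw [PowerSeries.coeff_C_mul, PowerSeries.coeff_mk, Fseries, PowerSeries.coeff_mk,
    (logDeriv_Lam L hN hcN).iteratedDeriv_eq, iteratedDeriv_const_mul_field, mul_div_assoc]
  congr 1
  -- The cases `k = 0, 1` would involve the weights `1` and `2`, where the lattice sums do not
  -- converge absolutely; both sides vanish there.
  match k with
  | 0 => simp [zetaDiffSum_zero L hN hcN, BH_of_le_three]
  | 1 => simp [deriv_zetaDiffSum_zero L hN hcN, BH_of_le_three]
  | k + 2 =>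
    have : (((k + 2).factorial : ℕ) : ℂ) ≠ 0 := by exact_mod_cast Nat.factorial_ne_zero _
    rw [iteratedDeriv_zetaDiffSum L hc hN hcN, mul_div_cancel_left₀ _ this,
      BH_div_factorial L (by omega)]

/-! ### Taylor expansion at the origin as a ring operation -/

/-- The Taylor series at `0` of a function `f`. -/
def taylorSeries (f : ℂ → ℂ) : PowerSeries ℂ :=
  PowerSeries.mk fun k => iteratedDeriv k f 0 / (k.factorial : ℂ)

lemma taylorSeries_congr {f g : ℂ → ℂ} (h : f =ᶠ[𝓝 0] g) : taylorSeries f = taylorSeries g := by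
  ext k
  simp only [taylorSeries, PowerSeries.coeff_mk, h.iteratedDeriv_eq]

lemma taylorSeries_mul {f g : ℂ → ℂ} (hf : AnalyticAt ℂ f 0) (hg : AnalyticAt ℂ g 0) :
    taylorSeries (fun z => f z * g z) = taylorSeries f * taylorSeries g := by
  ext k
  rw [PowerSeries.coeff_mul, taylorSeries, PowerSeries.coeff_mk,
    iteratedDeriv_fun_mul hf.contDiffAt hg.contDiffAt,
    Finset.Nat.sum_antidiagonal_eq_sum_range_succ_mk, Finset.sum_div]
  refine Finset.sum_congr rfl fun i hi => ?_
  have hi : i ≤ k := by simpa [Nat.lt_succ_iff] using hi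
  have h := Nat.choose_mul_factorial_mul_factorial hi
  have h1 : ((k.choose i : ℕ) : ℂ) * (i.factorial : ℂ) * ((k - i).factorial : ℂ) =
    (k.factorial : ℂ) := by exact_mod_cast h
  have h2 : (i.factorial : ℂ) ≠ 0 := by exact_mod_cast Nat.factorial_ne_zero _
  have h3 : ((k - i).factorial : ℂ) ≠ 0 := by exact_mod_cast Nat.factorial_ne_zero _
  have h4 : (k.factorial : ℂ) ≠ 0 := by exact_mod_cast Nat.factorial_ne_zero _
  simp only [taylorSeries, PowerSeries.coeff_mk]
  field_simp
  rw [← h1]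
  ring

lemma taylorSeries_add {f g : ℂ → ℂ} (hf : AnalyticAt ℂ f 0) (hg : AnalyticAt ℂ g 0) :
    taylorSeries (fun z => f z + g z) = taylorSeries f + taylorSeries g := by
  ext k
  simp only [taylorSeries, PowerSeries.coeff_mk, map_add]
  rw [iteratedDeriv_fun_add hf.contDiffAt hg.contDiffAt, add_div]

lemma taylorSeries_const (a : ℂ) : taylorSeries (fun _ => a) = PowerSeries.C a := by
  ext k
  simp only [taylorSeries, PowerSeries.coeff_mk, PowerSeries.coeff_C, iteratedDeriv_const]
  split_ifs with h <;> simp [h]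

lemma taylorSeries_id : taylorSeries (fun z => z) = PowerSeries.X := by
  ext k
  simp only [taylorSeries, PowerSeries.coeff_mk, PowerSeries.coeff_X]
  match k with
  | 0 => simp
  | 1 => simp
  | k + 2 => simp [iteratedDeriv_succ', iteratedDeriv_const]

lemma taylorSeries_pow {f : ℂ → ℂ} (hf : AnalyticAt ℂ f 0) (n : ℕ) :
    taylorSeries (fun z => f z ^ n) = taylorSeries f ^ n := by
  induction n with
  | zero => simpa using taylorSeries_const 1
  | succ n ih =>
    simp_rw [pow_succ]
    rw [taylorSeries_mul (hf.fun_pow n) hf, ih]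

end

/-! ### Rationality of the Eisenstein series -/

section

lemma coeff_mul_mem {K : Subfield ℂ} {n : ℕ} {f g : PowerSeries ℂ}
    (hf : ∀ m ≤ n, PowerSeries.coeff m f ∈ K) (hg : ∀ m ≤ n, PowerSeries.coeff m g ∈ K) :
    ∀ m ≤ n, PowerSeries.coeff m (f * g) ∈ K := by
  intro m hm
  rw [PowerSeries.coeff_mul]
  refine sum_mem fun p hp => ?_
  have := Finset.HasAntidiagonal.mem_antidiagonal.1 hp
  exact mul_mem (hf _ (by omega)) (hg _ (by omega))

lemma exists_eq_add_X_pow_mul (f : PowerSeries ℂ) (n : ℕ) :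
    ∃ t r : PowerSeries ℂ, f = t + PowerSeries.X ^ n * r ∧
      (∀ m, PowerSeries.coeff m t = if m < n then PowerSeries.coeff m f else 0) ∧
      PowerSeries.constantCoeff r = PowerSeries.coeff n f := by
  let t : PowerSeries ℂ := PowerSeries.mk fun m => if m < n then PowerSeries.coeff m f else 0
  have ht (m : ℕ) : PowerSeries.coeff m t = if m < n then PowerSeries.coeff m f else 0 :=
    PowerSeries.coeff_mk _ _
  obtain ⟨r, hr⟩ : PowerSeries.X ^ n ∣ f - t := PowerSeries.X_pow_dvd_iff.2 fun m hm => by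
    rw [map_sub, ht, if_pos hm, sub_self]
  refine ⟨t, r, by rw [← hr]; ring, ht, ?_⟩
  have := congrArg (PowerSeries.coeff n) hr
  rw [map_sub, ht, if_neg (lt_irrefl n), sub_zero, PowerSeries.coeff_X_pow_mul', if_pos le_rfl,
    Nat.sub_self, PowerSeries.coeff_zero_eq_constantCoeff_apply] at this
  exact this.symm

/-- A power series solution of the differential equation of `z² ℘(z)` has all its coefficients in
the field generated by `g₂` and `g₃`. -/
lemma coeff_mem_of_sq_eq {K : Subfield ℂ} {a b : ℂ} (ha : a ∈ K) (hb : b ∈ K)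
    {p s : PowerSeries ℂ} (hp : PowerSeries.coeff 0 p = 1)
    (hs : ∀ n, PowerSeries.coeff n s = (n - 2) * PowerSeries.coeff n p)
    (h : s ^ 2 = PowerSeries.C 4 * p ^ 3 - PowerSeries.C a * (PowerSeries.X ^ 4 * p) -
      PowerSeries.C b * PowerSeries.X ^ 6) (n : ℕ) :
    PowerSeries.coeff n p ∈ K := by
  induction n using Nat.strong_induction_on with
  | _ n ih =>
  rcases Nat.eq_zero_or_pos n with rfl | hn
  · rw [hp]; exact one_mem K
  -- Truncating below degree `n` isolates the contribution of the `n`-th coefficient, which is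
  -- linear because `n > 0`; the rest is in `K` by induction.
  obtain ⟨t, r, hpt, ht, hr⟩ := exists_eq_add_X_pow_mul p n
  obtain ⟨t', r', hst, ht', hr'⟩ := exists_eq_add_X_pow_mul s n
  have htK : ∀ m ≤ n, PowerSeries.coeff m t ∈ K := fun m _ => by
    rw [ht]
    split_ifs with hm
    · exact ih m hm
    · exact zero_mem K
  have htK' : ∀ m ≤ n, PowerSeries.coeff m t' ∈ K := fun m _ => by
    rw [ht']
    split_ifs with hm
    · rw [hs]
      exact mul_mem (sub_mem (natCast_mem K m) (ofNat_mem K 2)) (ih m hm)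
    · exact zero_mem K
  have ht0 : PowerSeries.constantCoeff t = 1 := by
    rw [← PowerSeries.coeff_zero_eq_constantCoeff_apply, ht, if_pos hn, hp]
  have ht0' : PowerSeries.constantCoeff t' = -2 := by
    rw [← PowerSeries.coeff_zero_eq_constantCoeff_apply, ht', if_pos hn, hs, hp]
    simp
  have e1 : PowerSeries.coeff n (s ^ 2) =
      PowerSeries.coeff n (t' * t') - 4 * (n - 2) * PowerSeries.coeff n p := by
    have : s ^ 2 = t' * t' + PowerSeries.X ^ n * (2 * t' * r' + PowerSeries.X ^ n * r' ^ 2) := by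
      rw [hst]; ring
    rw [this, map_add, PowerSeries.coeff_X_pow_mul', if_pos le_rfl, Nat.sub_self,
      PowerSeries.coeff_zero_eq_constantCoeff_apply]
    simp only [map_add, map_mul, map_pow, PowerSeries.constantCoeff_X, zero_pow hn.ne', ht0', hr',
      hs, map_ofNat]
    ring
  have e2 : PowerSeries.coeff n (p ^ 3) =
      PowerSeries.coeff n (t * (t * t)) + 3 * PowerSeries.coeff n p := by
    have : p ^ 3 = t * (t * t) + PowerSeries.X ^ n * (3 * t ^ 2 * r +
        PowerSeries.X ^ n * (3 * t * r ^ 2 + PowerSeries.X ^ n * r ^ 3)) := by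
      conv_lhs => rw [hpt]
      ring
    rw [this, map_add, PowerSeries.coeff_X_pow_mul', if_pos le_rfl, Nat.sub_self,
      PowerSeries.coeff_zero_eq_constantCoeff_apply]
    simp only [map_add, map_mul, map_pow, PowerSeries.constantCoeff_X, zero_pow hn.ne', ht0, hr,
      map_ofNat]
    ring
  have h1 := congrArg (PowerSeries.coeff n) h
  rw [map_sub, map_sub, PowerSeries.coeff_C_mul, PowerSeries.coeff_C_mul, PowerSeries.coeff_C_mul,
    e1, e2] at h1
  have m1 : PowerSeries.coeff n (t' * t') ∈ K := coeff_mul_mem htK' htK' n le_rfl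
  have m2 : PowerSeries.coeff n (t * (t * t)) ∈ K :=
    coeff_mul_mem htK (coeff_mul_mem htK htK) n le_rfl
  have m3 : PowerSeries.coeff n (PowerSeries.X ^ 4 * p) ∈ K := by
    rw [PowerSeries.coeff_X_pow_mul']
    split_ifs
    · exact ih _ (by omega)
    · exact zero_mem K
  have m4 : PowerSeries.coeff n (PowerSeries.X ^ 6 : PowerSeries ℂ) ∈ K := by
    rw [PowerSeries.coeff_X_pow]
    split_ifs
    · exact one_mem K
    · exact zero_mem K
  -- The unknown coefficient occurs with factor `-4(n - 2)` in `s²` and `12` in `4p³`; the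
  -- difference `12 + 4(n - 2) = 4(n + 1)` never vanishes.
  have hn1 : (4 * ((n : ℂ) + 1)) ≠ 0 := by
    have : ((n : ℂ) + 1) ≠ 0 := by exact_mod_cast n.succ_ne_zero
    simpa using this
  have h2 : PowerSeries.coeff n p = (PowerSeries.coeff n (t' * t') -
      4 * PowerSeries.coeff n (t * (t * t)) + a * PowerSeries.coeff n (PowerSeries.X ^ 4 * p) +
      b * PowerSeries.coeff n (PowerSeries.X ^ 6 : PowerSeries ℂ)) / (4 * ((n : ℂ) + 1)) := by
    rw [eq_div_iff hn1]
    linear_combination -h1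
  rw [h2]
  exact div_mem (add_mem (add_mem (sub_mem m1 (mul_mem (ofNat_mem K 4) m2)) (mul_mem ha m3))
    (mul_mem hb m4)) (mul_mem (ofNat_mem K 4) (add_mem (natCast_mem K n) (one_mem K)))

variable (L : PeriodPair)

/-- The function `z² ℘(z)`, extended to the origin by `1`. -/
def sqMulP (z : ℂ) : ℂ := 1 + z ^ 2 * ℘[L - (0 : ℂ)] z

/-- The function `z³ ℘'(z)`, extended to the origin by `-2`. -/
def cubeMulDerivP (z : ℂ) : ℂ := -2 + z ^ 3 * ℘'[L - (0 : ℂ)] z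

lemma sqMulP_eq {z : ℂ} (hz : z ≠ 0) : sqMulP L z = z ^ 2 * ℘[L] z := by
  have := L.weierstrassPExcept_add 0 z
  simp only [ZeroMemClass.coe_zero, sub_zero] at this
  rw [sqMulP, ← this]
  field_simp
  ring

lemma cubeMulDerivP_eq {z : ℂ} (hz : z ≠ 0) : cubeMulDerivP L z = z ^ 3 * ℘'[L] z := by
  have := L.derivWeierstrassPExcept_sub 0 z
  simp only [ZeroMemClass.coe_zero, sub_zero] at this
  rw [cubeMulDerivP, ← this]
  field_simp
  ring

@[fun_prop]
lemma analyticAt_sqMulP : AnalyticAt ℂ (sqMulP L) 0 := by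
  unfold sqMulP
  fun_prop

@[fun_prop]
lemma analyticAt_cubeMulDerivP : AnalyticAt ℂ (cubeMulDerivP L) 0 := by
  unfold cubeMulDerivP
  fun_prop

lemma cubeMulDerivP_sq : (fun z => cubeMulDerivP L z ^ 2) =ᶠ[𝓝 0] fun z =>
    4 * sqMulP L z ^ 3 + (-L.g₂ * (z ^ 4 * sqMulP L z) + -L.g₃ * z ^ 6) := by
  filter_upwards [L.compl_lattice_sdiff_singleton_mem_nhds 0] with z hz
  rcases eq_or_ne z 0 with rfl | hz0
  · simp [cubeMulDerivP, sqMulP]; norm_num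
  · have hz' : z ∉ L.lattice := fun h => hz ⟨h, hz0⟩
    rw [cubeMulDerivP_eq L hz0, sqMulP_eq L hz0]
    linear_combination z ^ 6 * L.derivWeierstrassP_sq z hz'

lemma coeff_taylorSeries_sqMulP (n : ℕ) : PowerSeries.coeff n (taylorSeries (sqMulP L)) =
    if n = 0 then 1 else if n ≤ 2 then 0 else (n - 1) * L.G n := by
  have h : taylorSeries (sqMulP L) = 1 + PowerSeries.X ^ 2 * taylorSeries ℘[L - (0 : ℂ)] := by
    unfold sqMulP
    rw [taylorSeries_add (by fun_prop) (by fun_prop), taylorSeries_mul (by fun_prop) (by fun_prop),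
      taylorSeries_pow (by fun_prop), taylorSeries_id, taylorSeries_const, map_one]
  rw [h, map_add, PowerSeries.coeff_X_pow_mul', PowerSeries.coeff_one]
  match n with
  | 0 => simp
  | 1 => simp
  | 2 => simp [taylorSeries]
  | n + 3 =>
    have h1 : (((n + 1).factorial : ℕ) : ℂ) ≠ 0 := by exact_mod_cast Nat.factorial_ne_zero _
    simp only [taylorSeries, PowerSeries.coeff_mk, L.iteratedDeriv_weierstrassPExcept_self,
      L.sumInvPow_zero]
    rw [if_neg (by omega), if_pos (by omega), if_neg (by omega), if_neg (by omega),
      if_neg (by omega), show n + 3 - 2 = n + 1 by omega, Nat.factorial_succ (n + 1)]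
    push_cast
    field_simp
    ring_nf

/-- The `n`-th coefficient of `z² ℘` belongs to `z^(n-2)` in `℘`, so differentiation multiplies it
by `n - 2`. -/
lemma coeff_taylorSeries_cubeMulDerivP (n : ℕ) :
    PowerSeries.coeff n (taylorSeries (cubeMulDerivP L)) =
      (n - 2) * PowerSeries.coeff n (taylorSeries (sqMulP L)) := by
  have h : taylorSeries (cubeMulDerivP L) =
      PowerSeries.C (-2) + PowerSeries.X ^ 3 * taylorSeries ℘'[L - (0 : ℂ)] := by
    unfold cubeMulDerivP
    rw [taylorSeries_add (by fun_prop) (by fun_prop), taylorSeries_mul (by fun_prop) (by fun_prop),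
      taylorSeries_pow (by fun_prop), taylorSeries_id, taylorSeries_const]
  rw [h, map_add, PowerSeries.coeff_X_pow_mul', PowerSeries.coeff_C, coeff_taylorSeries_sqMulP]
  match n with
  | 0 => simp
  | 1 => simp
  | 2 => simp
  | n + 3 =>
    have h1 : ((n.factorial : ℕ) : ℂ) ≠ 0 := by exact_mod_cast Nat.factorial_ne_zero _
    simp only [taylorSeries, PowerSeries.coeff_mk, L.iteratedDeriv_derivWeierstrassPExcept_self,
      L.sumInvPow_zero]
    rw [if_neg (by omega), if_pos (by omega), if_neg (by omega), if_neg (by omega),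
      show n + 3 - 3 = n by omega, Nat.factorial_succ (n + 1), Nat.factorial_succ n]
    push_cast
    field_simp
    ring_nf

/-- The Eisenstein series of a lattice are rational over every field that contains `g₂`
and `g₃`. -/
theorem G_mem {K : Subfield ℂ} (h₂ : L.g₂ ∈ K) (h₃ : L.g₃ ∈ K) {n : ℕ} (hn : 3 ≤ n) :
    L.G n ∈ K := by
  have h := taylorSeries_congr (cubeMulDerivP_sq L)
  rw [taylorSeries_pow (by fun_prop), taylorSeries_add (by fun_prop) (by fun_prop),
    taylorSeries_add (by fun_prop) (by fun_prop), taylorSeries_mul (by fun_prop) (by fun_prop),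
    taylorSeries_mul (by fun_prop) (by fun_prop), taylorSeries_mul (by fun_prop) (by fun_prop),
    taylorSeries_mul (by fun_prop) (by fun_prop), taylorSeries_pow (by fun_prop),
    taylorSeries_pow (by fun_prop), taylorSeries_pow (by fun_prop), taylorSeries_id,
    taylorSeries_const, taylorSeries_const, taylorSeries_const] at h
  have hmem := coeff_mem_of_sq_eq h₂ h₃ (by simp [coeff_taylorSeries_sqMulP])
    (coeff_taylorSeries_cubeMulDerivP L) (by rw [h, map_neg, map_neg]; ring) n
  rw [coeff_taylorSeries_sqMulP, if_neg (by omega), if_neg (by omega)] at hmem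
  have h1 : (n : ℂ) - 1 ≠ 0 := sub_ne_zero.2 (by norm_cast; omega)
  rw [← mul_div_cancel_left₀ (L.G n) h1]
  exact div_mem hmem (sub_mem (natCast_mem K n) (one_mem K))

/-- Multiplying by `z²` and letting `z → 0` isolates `a`, by the double pole; any point off the
lattice, such as `ω₁/2`, then gives `b`. -/
lemma eq_zero_of_mul_weierstrassP_add_eq_zero {a b : ℂ}
    (h : ∀ z ∉ L.lattice, a * ℘[L] z + b = 0) : a = 0 ∧ b = 0 := by
  have h1 : (fun z => a * sqMulP L z + b * z ^ 2) =ᶠ[𝓝[≠] 0] fun _ => 0 := by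
    filter_upwards [self_mem_nhdsWithin,
      mem_nhdsWithin_of_mem_nhds (L.compl_lattice_sdiff_singleton_mem_nhds 0)] with z hz0 hz
    have hz' : z ∉ L.lattice := fun h => hz ⟨h, hz0⟩
    rw [sqMulP_eq L hz0]
    linear_combination z ^ 2 * h z hz'
  have h2 : ContinuousAt (fun z => a * sqMulP L z + b * z ^ 2) 0 :=
    AnalyticAt.continuousAt (𝕜 := ℂ) (by fun_prop)
  have h3 := tendsto_nhds_unique (h2.tendsto.mono_left nhdsWithin_le_nhds)
    (tendsto_const_nhds.congr' h1.symm)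
  have ha : a = 0 := by simpa [sqMulP] using h3
  refine ⟨ha, ?_⟩
  have := h _ L.ω₁_div_two_notMem_lattice
  simpa [ha] using this

/-- Subtracting four times the equation of `E` at `(℘, ℘'/2)` from the differential equation of `℘`
leaves a linear relation in `℘`, whose coefficients must vanish. -/
lemma invariants_of_isPeriodLattice {F : Type*} [Field F] [Algebra F ℂ] {E : WeierstrassCurve F}
    [E.IsShortNF] {L : PeriodPair} (hL : IsPeriodLattice E L) :
    L.g₂ = -4 * algebraMap F ℂ E.a₄ ∧ L.g₃ = -4 * algebraMap F ℂ E.a₆ := by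
  obtain ⟨φ, -, hφ⟩ := hL
  have h := eq_zero_of_mul_weierstrassP_add_eq_zero L (a := L.g₂ + 4 * algebraMap F ℂ E.a₄)
    (b := L.g₃ + 4 * algebraMap F ℂ E.a₆) fun z hz => by
    obtain ⟨hns, -⟩ := hφ z hz
    have h1 := (WeierstrassCurve.Affine.equation_iff _ _).1 hns.1
    simp only [WeierstrassCurve.toAffine, WeierstrassCurve.baseChange, WeierstrassCurve.map_a₁,
      WeierstrassCurve.map_a₂, WeierstrassCurve.map_a₃, WeierstrassCurve.map_a₄,
      WeierstrassCurve.map_a₆, E.a₁_of_isShortNF, E.a₂_of_isShortNF, E.a₃_of_isShortNF,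
      map_zero] at h1
    linear_combination L.derivWeierstrassP_sq z hz - 4 * h1
  exact ⟨by linear_combination h.1, by linear_combination h.2⟩

theorem G_mem_of_isPeriodLattice {F : Type*} [Field F] [Algebra F ℂ] {E : WeierstrassCurve F}
    [E.IsShortNF] {L : PeriodPair} (hL : IsPeriodLattice E L) {n : ℕ} (hn : 3 ≤ n) :
    L.G n ∈ (algebraMap F ℂ).fieldRange := by
  obtain ⟨h₂, h₃⟩ := invariants_of_isPeriodLattice hL
  have h4 : (-4 : ℂ) ∈ (algebraMap F ℂ).fieldRange := neg_mem (ofNat_mem _ 4)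
  refine G_mem L ?_ ?_ hn
  · rw [h₂]
    exact mul_mem h4 ⟨_, rfl⟩
  · rw [h₃]
    exact mul_mem h4 ⟨_, rfl⟩

end

end BernoulliHurwitz

end

/-! ### Main theorem -/

theorem mainTheorem11 {F : Type*} [Field F] [Algebra F ℂ]
    (E : WeierstrassCurve F) [E.IsElliptic] [E.IsShortNF]
    (L : PeriodPair) (hL : BernoulliHurwitz.IsPeriodLattice E L)
    (c N : ℕ) (hc : 1 < c) (hN : 1 < N) (hcN : Nat.Coprime c N) :
    (AnalyticAt ℂ (BernoulliHurwitz.Lam c N L) 0 ∧ BernoulliHurwitz.Lam c N L 0 ≠ 0) ∧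
    (∃ f : PowerSeries F,
      PowerSeries.map (algebraMap F ℂ) f = BernoulliHurwitz.Fseries c N L) ∧
    BernoulliHurwitz.Fseries c N L =
      PowerSeries.C (12 : ℂ) * PowerSeries.mk fun k : ℕ =>
        ((c : ℂ) ^ 2 - (c : ℂ) ^ (k + 1)) * (1 - (N : ℂ) ^ (k + 1)) *
          (BernoulliHurwitz.BH L (k + 1) / ((k + 1).factorial : ℂ)) := by
  refine ⟨⟨BernoulliHurwitz.analyticAt_Lam L hN hcN, BernoulliHurwitz.Lam_ne_zero L hN hcN⟩, ?_,
    BernoulliHurwitz.Fseries_eq L hc hN hcN⟩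
  have hmem (k : ℕ) : PowerSeries.coeff k (BernoulliHurwitz.Fseries c N L) ∈
      (algebraMap F ℂ).fieldRange := by
    have hBH : BernoulliHurwitz.BH L (k + 1) / ((k + 1).factorial : ℂ) ∈
        (algebraMap F ℂ).fieldRange := by
      rcases le_or_gt 3 (k + 1) with h | h
      · rw [BernoulliHurwitz.BH_div_factorial L h]
        exact BernoulliHurwitz.G_mem_of_isPeriodLattice hL h
      · rw [BernoulliHurwitz.BH_of_le_three L h.le, zero_div]
        exact zero_mem _
    rw [BernoulliHurwitz.Fseries_eq L hc hN hcN, PowerSeries.coeff_C_mul, PowerSeries.coeff_mk]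
    exact mul_mem (ofNat_mem _ 12) (mul_mem (mul_mem
      (sub_mem (pow_mem (natCast_mem _ c) _) (pow_mem (natCast_mem _ c) _))
      (sub_mem (one_mem _) (pow_mem (natCast_mem _ N) _))) hBH)
  choose a ha using hmem
  refine ⟨PowerSeries.mk a, ?_⟩
  ext k
  rw [PowerSeries.coeff_map, PowerSeries.coeff_mk, ha]
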